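/- **Proposition (Equidistribution).** Let $\mathbb T^1=\mathbb R/\mathbb Z$, $\mathbb T^2=\mathbb T^1\times\mathbb T^1$, and for $L>0$ let $F=F_L:\mathbb T^2\to\mathbb T^2$ be the standard map $$F_L(x,y)=\bigl(2x-y+L\sin(2\pi x)\ (\mathrm{mod}\ 1),\ x\bigr).$$ A *u-curve* (for the parameter $L$) is a graph $\gamma=\{(x,h(x)):x\in I\}\subset\mathbb T^2$, where $I\subsetneq\mathbb T^1$ is an open interval and $h:I\to\mathbb T^1$ is $C^2$ with $\sup_I|\dot h|\le 1/10$ and $\sup_I|\ddot h|\le L$; it is *fully crossing* if $I=(0,1)$. A *measure pair* $(\gamma,\rho)$ is a u-curve $\gamma$ with a positive $C^1$ probability density $\rho$ on $I$; it is identified with the probability measure on $\mathbb T^2$ that is the push-forward of $\rho(x)\,dx$ under $x\mapsto(x,h(x))$. Given $a_0\in(0,1/8]$, a measure pair is a *standard pair* if $|I|>a_0$ and $\sup_I\bigl|\tfrac{d\log\rho}{dx}\bigr|\le 3C_0$ with $C_0=8\pi^2$; it is a *fully-crossing standard pair* if in addition $\gamma$ is fully crossing. There are constants $C>0$ and $L_0>0$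 such that for every $a_0\in(0,1/8]$, every $L\ge L_0$, every fully-crossing standard pair $(\gamma,\rho)$, every $C^1$ function $\phi:\mathbb T^1\to\mathbb R$ with $\int_{\mathbb T^1}\phi\,dx=0$, and every integer $n\ge1$, $$\left|\int\phi\circ F_L^n\,d(\gamma,\rho)\right|\le C\,\|\phi\|_{C^0}\Bigl((n-1)L^{-3/4}+L^{-1/2}\Bigr),$$ where $\phi$ is regarded as the function $(x,y)\mapsto\phi(x)$ on $\mathbb T^2$ and $\|\phi\|_{C^0}=\sup_{\mathbb T^1}|\phi|$. -/

import Mathlib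

open MeasureTheory Set

noncomputable section

namespace StandardMap

/-- The two-torus, the product of two circles `ℝ / ℤ`. -/
abbrev Torus : Type := UnitAddCircle × UnitAddCircle

/-- The function `x ↦ sin (2 π x)` on the circle `ℝ / ℤ`. -/
def sinTwoPi : UnitAddCircle → ℝ :=
  Function.Periodic.lift (f := fun x : ℝ => Real.sin (2 * Real.pi * x)) (c := 1) (by
    intro x
    simp only [mul_add, mul_one]
    exact Real.sin_add_two_pi _)

/-- The standard map `F_L (x, y) = (2 x - y + L sin (2 π x) mod 1, x)` on the torus. -/
def F (L : ℝ) (p : Torus) : Torus :=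
  ((2 : ℕ) • p.1 - p.2 + ((L * sinTwoPi p.1 : ℝ) : UnitAddCircle), p.1)

/-- A u-curve: the graph in the torus of a `C²` map `h` with values in the circle, defined on a
proper open interval of the circle. The interval is the projection of the real interval
`(left, right)`; the normalisation `0 ≤ left < 1` makes the end points unique, and
`right ≤ left + 1` says that it is embedded and is not the whole circle. The map `h` is written in
the real coordinate of the interval; only its values on `(left, right)` matter. That `h` is `C²`,
and the size of its derivatives, is read off from a real-valued lift `H` of `h`. -/
structure UCurve (L : ℝ) where
  left : ℝ
  right : ℝ
  left_nonneg : 0 ≤ left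
  left_lt_one : left < 1
  left_lt_right : left < right
  right_le : right ≤ left + 1
  h : ℝ → UnitAddCircle
  exists_lift : ∃ H : ℝ → ℝ,
    (∀ x ∈ Ioo left right, (H x : UnitAddCircle) = h x) ∧
    ContDiffOn ℝ 2 H (Ioo left right) ∧
    (∀ x ∈ Ioo left right, |deriv H x| ≤ 1 / 10) ∧
    (∀ x ∈ Ioo left right, |deriv (deriv H) x| ≤ L)

/-- The real interval that parametrises the domain of the u-curve. -/
def UCurve.interval {L : ℝ} (γ : UCurve L) : Set ℝ := Ioo γ.left γ.right

/-- The parametrisation `x ↦ (x, h x)` of the u-curve. -/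
def UCurve.param {L : ℝ} (γ : UCurve L) (x : ℝ) : Torus := ((x : UnitAddCircle), γ.h x)

/-- A u-curve is fully crossing if its domain is `(0, 1)`. -/
def UCurve.IsFullyCrossing {L : ℝ} (γ : UCurve L) : Prop := γ.left = 0 ∧ γ.right = 1

/-- A measure pair: a u-curve together with a positive `C¹` probability density on its domain. -/
structure MeasurePair (L : ℝ) where
  γ : UCurve L
  ρ : ℝ → ℝ
  ρ_pos : ∀ x ∈ γ.interval, 0 < ρ x
  ρ_contDiffOn : ContDiffOn ℝ 1 ρ γ.interval
  ρ_integral : ∫ x in γ.interval, ρ x = 1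

/-- The measure on the torus that a measure pair stands for: the push-forward of `ρ dx` under
the parametrisation `x ↦ (x, h x)`. -/
def MeasurePair.toMeasure {L : ℝ} (P : MeasurePair L) : Measure Torus :=
  ((volume.restrict P.γ.interval).withDensity fun x => ENNReal.ofReal (P.ρ x)).map P.γ.param

/-- The distortion constant `8 π²`. -/
def C₀ : ℝ := 8 * Real.pi ^ 2

/-- A standard pair (with length threshold `a₀`): the length of the curve is larger than `a₀`, and
the logarithmic derivative of the density is at most `3 C₀`. -/
def MeasurePair.IsStandard {L : ℝ} (a₀ : ℝ) (P : MeasurePair L) : Prop :=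
  a₀ < P.γ.right - P.γ.left ∧
  ∀ x ∈ P.γ.interval, |deriv (fun t => Real.log (P.ρ t)) x| ≤ 3 * C₀

/-- A fully-crossing standard pair: a standard pair whose curve is fully crossing. -/
def MeasurePair.IsFullyCrossingStandard {L : ℝ} (a₀ : ℝ) (P : MeasurePair L) : Prop :=
  P.IsStandard a₀ ∧ P.γ.IsFullyCrossing

end StandardMap

end

noncomputable section

namespace StandardMap

/-! ### A truncated inverse and a `C¹` extension of the inverse -/

/-! The curve is never cut into standard pieces. Its image is carried as one parametrised curve `t ↦
(X t, Y t)` with weight `w`, and all that is controlled is the variation `V` of the density `u = w /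
X'`, end-point jumps included. Integrating `∫ u f(X) X'` by parts against the primitive of a
mean-zero periodic `f`, which is bounded by `∫ |f|`, gives `|∫ w f(X)| ≤ (∫ |f|) V`
(`WeightedCurve.abs_integral_w_mul_le`).

The map stretches the abscissa by `a = 2 + 2πL cos(2πX) - r`, where `r` is the slope, so `u` becomes
`u / a`. This is singular near the zeros of `a`, so a smooth cutoff discards weight there: `a⁻¹` is
replaced by `cutInv A a`. The discarded weight and the variation created by the cutoff are both
controlled by the integral of `w / max(a², A²)`. That is the integral of an observable of `X`, up to
a bounded factor, so the same equidistribution estimate bounds it by `(1 + 2V) / (AL)`. Hence a step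
turns `V` into at most `(41 + 83V) / A` (`WeightedCurve.variation_step_le`) and loses mass at most
`2(A/L)(1 + 2V)` (`WeightedCurve.integral_w_sub_step_le`).

The first `n - 1` steps use `A = L^(1/4)`: `V` stays bounded and each loses `O(L^(-3/4))`. The last
uses `A' = L^(1/2)`, so that the loss and the final variation are both `O(L^(-1/2))`. -/

theorem hasDerivAt_comp_max {f f' : ℝ → ℝ} {c : ℝ} (hf : ∀ s, c ≤ s → HasDerivAt f (f' s) s)
    (hc : f' c = 0) (s : ℝ) : HasDerivAt (fun t => f (max t c)) (f' (max s c)) s := by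
  rcases lt_trichotomy s c with h | rfl | h
  · rw [max_eq_right h.le, hc]
    refine (hasDerivAt_const s (f c)).congr_of_eventuallyEq ?_
    filter_upwards [Iio_mem_nhds h] with t ht
    rw [max_eq_right (le_of_lt ht)]
  · rw [max_self]
    have h1 : HasDerivWithinAt (fun t => f (max t s)) (f' s) (Iic s) s := by
      rw [hc]
      exact (hasDerivWithinAt_const s _ (f s)).congr
        (fun t ht => by rw [max_eq_right ht]) (by rw [max_self])
    have h2 : HasDerivWithinAt (fun t => f (max t s)) (f' s) (Ici s) s :=
      (hf s le_rfl).hasDerivWithinAt.congr (fun t ht => by rw [max_eq_left ht]) (by rw [max_self])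
    have h3 := h1.union h2
    rwa [Iic_union_Ici, hasDerivWithinAt_univ] at h3
  · rw [max_eq_left h.le]
    refine (hf s h.le).congr_of_eventuallyEq ?_
    filter_upwards [Ioi_mem_nhds h] with t ht
    rw [max_eq_left (le_of_lt ht)]

/-- A `C¹` function that equals `a⁻¹` for `A ≤ |a|`. -/
def extInv (A a : ℝ) : ℝ :=
  a * ((max (a ^ 2) (A ^ 2))⁻¹ + max (a ^ 2) (A ^ 2) / A ^ 4 - a ^ 2 / A ^ 4)

/-- The derivative of `extInv A`. -/
def extInvDeriv (A a : ℝ) : ℝ :=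
  ((max (a ^ 2) (A ^ 2))⁻¹ + max (a ^ 2) (A ^ 2) / A ^ 4 - a ^ 2 / A ^ 4) +
    a * ((-(max (a ^ 2) (A ^ 2) ^ 2)⁻¹ + 1 / A ^ 4) * (2 * a) - 2 * a / A ^ 4)

/-- A `C¹` function that equals `a⁻¹ (1 - A² / a²)²` for `A ≤ |a|` and vanishes elsewhere. -/
def cutInv (A a : ℝ) : ℝ :=
  a * ((max (a ^ 2) (A ^ 2) - A ^ 2) ^ 2 / max (a ^ 2) (A ^ 2) ^ 3)

/-- The derivative of `cutInv A`. -/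
def cutInvDeriv (A a : ℝ) : ℝ :=
  (max (a ^ 2) (A ^ 2) - A ^ 2) ^ 2 / max (a ^ 2) (A ^ 2) ^ 3 +
    a * ((2 * (max (a ^ 2) (A ^ 2) - A ^ 2) / max (a ^ 2) (A ^ 2) ^ 3 -
      3 * (max (a ^ 2) (A ^ 2) - A ^ 2) ^ 2 / max (a ^ 2) (A ^ 2) ^ 4) * (2 * a))

section TruncatedInverse

variable {A : ℝ}

theorem max_sq_pos (hA : 0 < A) (a : ℝ) : 0 < max (a ^ 2) (A ^ 2) :=
  lt_max_of_lt_right (by positivity)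

theorem hasDerivAt_extInv (hA : 0 < A) (a : ℝ) : HasDerivAt (extInv A) (extInvDeriv A a) a := by
  have hsq : HasDerivAt (fun a : ℝ => a ^ 2) (2 * a) a := by simpa using hasDerivAt_pow 2 a
  -- The term `s / A ^ 4` makes the derivative vanish at `s = A²`, so truncating there stays `C¹`;
  -- subtracting `a² / A ^ 4` afterwards restores `a⁻²` where `A ≤ |a|`.
  have hf := hasDerivAt_comp_max (f := fun s => s⁻¹ + s / A ^ 4)
    (f' := fun s => -(s ^ 2)⁻¹ + 1 / A ^ 4) (c := A ^ 2)
    (fun s hs => (hasDerivAt_inv (lt_of_lt_of_le (by positivity) hs).ne').add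
      ((hasDerivAt_id s).div_const _)) (by ring) (a ^ 2)
  have h := (hasDerivAt_id a).mul ((HasDerivAt.comp (h := fun a : ℝ => a ^ 2) a hf hsq).sub (hsq.div_const (A ^ 4)))
  refine h.congr_deriv ?_
  simp [extInvDeriv]

theorem hasDerivAt_cutInv (hA : 0 < A) (a : ℝ) : HasDerivAt (cutInv A) (cutInvDeriv A a) a := by
  have hsq : HasDerivAt (fun a : ℝ => a ^ 2) (2 * a) a := by simpa using hasDerivAt_pow 2 a
  have hf := hasDerivAt_comp_max (f := fun s => (s - A ^ 2) ^ 2 / s ^ 3)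
    (f' := fun s => 2 * (s - A ^ 2) / s ^ 3 - 3 * (s - A ^ 2) ^ 2 / s ^ 4) (c := A ^ 2)
    (fun s hs => by
      have hs0 : s ≠ 0 := (lt_of_lt_of_le (by positivity) hs).ne'
      have h2 : HasDerivAt (fun s : ℝ => (s - A ^ 2) ^ 2) (2 * (s - A ^ 2)) s := by
        simpa using ((hasDerivAt_id s).sub_const (A ^ 2)).fun_pow 2
      refine (h2.fun_div (hasDerivAt_pow 3 s) (pow_ne_zero 3 hs0)).congr_deriv ?_
      push_cast
      field_simp) (by simp) (a ^ 2)
  have h := (hasDerivAt_id a).mul (HasDerivAt.comp (h := fun a : ℝ => a ^ 2) a hf hsq)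
  refine h.congr_deriv ?_
  simp [cutInvDeriv]

theorem continuous_extInvDeriv (hA : 0 < A) : Continuous (extInvDeriv A) := by
  have h1 : ∀ a : ℝ, max (a ^ 2) (A ^ 2) ≠ 0 := fun a => (max_sq_pos hA a).ne'
  have h2 : ∀ a : ℝ, max (a ^ 2) (A ^ 2) ^ 2 ≠ 0 := fun a => pow_ne_zero 2 (h1 a)
  unfold extInvDeriv
  fun_prop (disch := assumption)

theorem continuous_cutInvDeriv (hA : 0 < A) : Continuous (cutInvDeriv A) := by
  have h1 : ∀ a : ℝ, max (a ^ 2) (A ^ 2) ^ 3 ≠ 0 := fun a => pow_ne_zero 3 (max_sq_pos hA a).ne'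
  have h2 : ∀ a : ℝ, max (a ^ 2) (A ^ 2) ^ 4 ≠ 0 := fun a => pow_ne_zero 4 (max_sq_pos hA a).ne'
  unfold cutInvDeriv
  fun_prop (disch := assumption)

theorem cutInv_of_sq_le {a : ℝ} (h : a ^ 2 ≤ A ^ 2) : cutInv A a = 0 := by
  simp [cutInv, max_eq_right h]

theorem cutInvDeriv_of_sq_le {a : ℝ} (h : a ^ 2 ≤ A ^ 2) : cutInvDeriv A a = 0 := by
  simp [cutInvDeriv, max_eq_right h]

theorem extInv_of_sq_le {a : ℝ} (hA : 0 < A) (h : A ^ 2 ≤ a ^ 2) : extInv A a = a⁻¹ := by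
  have ha0 : a ≠ 0 := by rintro rfl; nlinarith [pow_pos hA 2]
  rw [extInv, max_eq_left h]; field_simp; ring

theorem abs_extInv_le (hA : 0 < A) (a : ℝ) : |extInv A a| ≤ 2 / A := by
  rcases le_total (a ^ 2) (A ^ 2) with h | h
  · have ha : |a| ≤ A := abs_le_of_sq_le_sq h hA.le
    have hn : 0 ≤ 2 * A ^ 2 - a ^ 2 := by nlinarith [sq_nonneg a]
    have e : extInv A a = a * ((2 * A ^ 2 - a ^ 2) / A ^ 4) := by
      rw [extInv, max_eq_right h]; field_simp; ring
    rw [e, abs_mul, abs_of_nonneg (div_nonneg hn (by positivity))]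
    calc |a| * ((2 * A ^ 2 - a ^ 2) / A ^ 4) ≤ A * ((2 * A ^ 2) / A ^ 4) := by
          gcongr
          linarith [sq_nonneg a]
      _ = 2 / A := by field_simp
  · have ha : A ≤ |a| := by rw [← abs_of_pos hA]; exact sq_le_sq.1 h
    rw [extInv_of_sq_le hA h, abs_inv, inv_eq_one_div]
    gcongr
    norm_num

theorem extInvDeriv_of_sq_le {a : ℝ} (hA : 0 < A) (h : A ^ 2 ≤ a ^ 2) :
    extInvDeriv A a = -(a ^ 2)⁻¹ := by
  have ha0 : a ≠ 0 := by rintro rfl; nlinarith [pow_pos hA 2]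
  rw [extInvDeriv, max_eq_left h]; field_simp; ring

theorem mul_cutInv_eq_of_sq_le {a : ℝ} (hA : 0 < A) (h : A ^ 2 ≤ a ^ 2) :
    a * cutInv A a = (1 - A ^ 2 / a ^ 2) ^ 2 := by
  have ha0 : a ≠ 0 := by rintro rfl; nlinarith [pow_pos hA 2]
  rw [cutInv, max_eq_left h]; field_simp

theorem mul_cutInv_nonneg (hA : 0 < A) (a : ℝ) : 0 ≤ a * cutInv A a := by
  have := max_sq_pos hA a
  rw [cutInv, ← mul_assoc, ← sq]
  positivity

theorem div_sq_mem_Icc {a : ℝ} (hA : 0 < A) (h : A ^ 2 ≤ a ^ 2) : A ^ 2 / a ^ 2 ∈ Icc (0 : ℝ) 1 :=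
  ⟨by positivity, div_le_one_of_le₀ h (by positivity)⟩

theorem mul_cutInv_le_one (hA : 0 < A) (a : ℝ) : a * cutInv A a ≤ 1 := by
  rcases le_total (a ^ 2) (A ^ 2) with h | h
  · simp [cutInv_of_sq_le h]
  · rw [mul_cutInv_eq_of_sq_le hA h]
    obtain ⟨h0, h1⟩ := div_sq_mem_Icc hA h
    nlinarith

/-- This is the fraction of weight lost in a step. With `s = A² / a²` it is `1 - (1 - s)² ≤ 2s` off
the truncated region. -/
theorem one_sub_mul_cutInv_le (hA : 0 < A) (a : ℝ) :
    1 - a * cutInv A a ≤ 2 * A ^ 2 * (max (a ^ 2) (A ^ 2))⁻¹ := by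
  rcases le_total (a ^ 2) (A ^ 2) with h | h
  · rw [cutInv_of_sq_le h, max_eq_right h, mul_assoc, mul_inv_cancel₀ (by positivity)]
    norm_num
  · rw [mul_cutInv_eq_of_sq_le hA h, max_eq_left h, mul_assoc, ← div_eq_mul_inv]
    nlinarith [sq_nonneg (A ^ 2 / a ^ 2)]

theorem abs_cutInv_le (hA : 0 < A) (a : ℝ) : |cutInv A a| ≤ A⁻¹ := by
  rcases le_total (a ^ 2) (A ^ 2) with h | h
  · simp [cutInv_of_sq_le h, hA.le]
  · have ha : A ≤ |a| := by rw [← abs_of_pos hA]; exact sq_le_sq.1 h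
    have h1 := mul_cutInv_le_one hA a
    rw [← abs_of_nonneg (mul_cutInv_nonneg hA a), abs_mul] at h1
    rw [inv_eq_one_div, le_div_iff₀ hA]
    nlinarith [abs_nonneg (cutInv A a)]

theorem abs_cutInvDeriv_le (hA : 0 < A) (a : ℝ) :
    |cutInvDeriv A a| ≤ (max (a ^ 2) (A ^ 2))⁻¹ := by
  rcases le_total (a ^ 2) (A ^ 2) with h | h
  · rw [cutInvDeriv_of_sq_le h, abs_zero]
    exact (inv_pos.2 (max_sq_pos hA a)).le
  · obtain ⟨h0, h1⟩ := div_sq_mem_Icc hA h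
    have ha0 : a ≠ 0 := by rintro rfl; nlinarith [pow_pos hA 2]
    have e : cutInvDeriv A a =
        (1 - A ^ 2 / a ^ 2) * (5 * (A ^ 2 / a ^ 2) - 1) * (a ^ 2)⁻¹ := by
      rw [cutInvDeriv, max_eq_left h]; field_simp; ring
    rw [e, max_eq_left h, abs_mul, abs_of_pos (inv_pos.2 (by positivity : 0 < a ^ 2))]
    -- With `s = A² / a²` in `[0, 1]`, the factor `(1 - s)(5s - 1)` ranges from `-1` at `s = 0` to
    -- `4/5` at `s = 3/5`.
    refine mul_le_of_le_one_left (by positivity) (abs_le.2 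
      ⟨by nlinarith, by nlinarith [sq_nonneg (A ^ 2 / a ^ 2 - 3 / 5)]⟩)

/-- On the support of the cutoff, `extInv` is the true inverse. This keeps the slope relation exact
wherever weight survives. -/
theorem cutInv_mul_extInv (hA : 0 < A) (a : ℝ) :
    cutInv A a * (extInv A a * a - 1) = 0 := by
  rcases le_total (a ^ 2) (A ^ 2) with h | h
  · simp [cutInv_of_sq_le h]
  · have ha0 : a ≠ 0 := by rintro rfl; nlinarith [pow_pos hA 2]
    rw [extInv_of_sq_le hA h, inv_mul_cancel₀ ha0]; simp

theorem abs_cutInv_mul_extInvDeriv_le (hA : 0 < A) (a : ℝ) :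
    |cutInv A a * extInvDeriv A a| ≤ a * cutInv A a * (A ^ 3)⁻¹ := by
  rcases le_total (a ^ 2) (A ^ 2) with h | h
  · simp [cutInv_of_sq_le h]
  · have ha : A ≤ |a| := by rw [← abs_of_pos hA]; exact sq_le_sq.1 h
    have ha0 : a ≠ 0 := by rintro rfl; nlinarith [pow_pos hA 2]
    rw [extInvDeriv_of_sq_le hA h]
    rw [← abs_of_nonneg (mul_cutInv_nonneg hA a)]
    rw [abs_mul, abs_mul, abs_neg, abs_inv, abs_pow]
    have hpos : 0 < |a| := abs_pos.2 ha0
    calc |cutInv A a| * (|a| ^ 2)⁻¹ = |a| * |cutInv A a| * (|a| ^ 3)⁻¹ := by field_simp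
      _ ≤ |a| * |cutInv A a| * (A ^ 3)⁻¹ := by gcongr

end TruncatedInverse

/-! ### Periodic functions -/

/-- Mean zero makes the primitive periodic, so only `x` in `[0, 1)` matters. -/
theorem abs_primitive_le_of_periodic {f : ℝ → ℝ} (hf : Continuous f)
    (hp : Function.Periodic f 1) (h0 : ∫ t in (0 : ℝ)..1, f t = 0) (x : ℝ) :
    |∫ t in (0 : ℝ)..x, f t| ≤ ∫ t in (0 : ℝ)..1, |f t| := by
  have hper : Function.Periodic (fun x : ℝ => ∫ t in (0 : ℝ)..x, f t) 1 := by
    intro x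
    have h1 := hp.intervalIntegral_add_eq x 0
    rw [zero_add, h0] at h1
    simp only
    rw [← intervalIntegral.integral_add_adjacent_intervals (hf.intervalIntegrable 0 x)
      (hf.intervalIntegrable x (x + 1)), h1, add_zero]
  have h2 : (∫ t in (0 : ℝ)..x, f t) = ∫ t in (0 : ℝ)..Int.fract x, f t := by
    have := hper.sub_int_mul_eq ⌊x⌋ (x := x)
    simp only [mul_one] at this
    exact this.symm
  have hy0 := Int.fract_nonneg x
  rw [h2]
  refine (intervalIntegral.abs_integral_le_integral_abs hy0).trans ?_
  exact intervalIntegral.integral_mono_interval le_rfl hy0 (Int.fract_lt_one x).le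
    (Filter.Eventually.of_forall fun t => abs_nonneg _) (hf.abs.intervalIntegrable 0 1)

theorem four_mul_abs_le_abs_sin {t : ℝ} (ht : |t| ≤ 1 / 4) :
    4 * |t| ≤ |Real.sin (2 * Real.pi * t)| := by
  have hpi := Real.pi_pos
  have h : |2 * Real.pi * t| ≤ Real.pi / 2 := by
    rw [abs_mul, abs_of_pos (by positivity)]; nlinarith
  have h2 := Real.mul_abs_le_abs_sin h
  rw [abs_mul, abs_of_pos (by positivity : 0 < 2 * Real.pi)] at h2
  calc 4 * |t| = 2 / Real.pi * (2 * Real.pi * |t|) := by field_simp; ring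
    _ ≤ _ := h2

theorem integral_inv_sq_add_sq_le {A B : ℝ} (hA : 0 < A) (hB : 0 < B) (p q c : ℝ) :
    ∫ x in p..q, (A ^ 2 + B ^ 2 * (x - c) ^ 2)⁻¹ ≤ Real.pi / (A * B) := by
  have hd : ∀ x : ℝ, HasDerivAt (fun x => Real.arctan (B / A * (x - c)) / (A * B))
      ((A ^ 2 + B ^ 2 * (x - c) ^ 2)⁻¹) x := by
    intro x
    refine (((((hasDerivAt_id x).sub_const c).const_mul (B / A)).arctan).div_const
      (A * B)).congr_deriv ?_
    simp only [id]
    have h1 : 0 < A ^ 2 + B ^ 2 * (x - c) ^ 2 := by positivity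
    have h2 : 0 < 1 + (B / A * (x - c)) ^ 2 := by positivity
    field_simp
  have hc : Continuous fun x : ℝ => (A ^ 2 + B ^ 2 * (x - c) ^ 2)⁻¹ := by
    refine Continuous.inv₀ (by fun_prop) fun x => ?_
    positivity
  rw [intervalIntegral.integral_eq_sub_of_hasDerivAt (fun x _ => hd x)
    (hc.intervalIntegrable p q), ← sub_div]
  gcongr
  linarith [Real.arctan_lt_pi_div_two (B / A * (q - c)),
    Real.neg_pi_div_two_lt_arctan (B / A * (p - c))]

theorem continuous_inv_sq_add_sq_cos {A : ℝ} (hA : 0 < A) (B : ℝ) :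
    Continuous fun x : ℝ => (A ^ 2 + (B * Real.cos (2 * Real.pi * x)) ^ 2)⁻¹ := by
  refine Continuous.inv₀ (by fun_prop) fun x => ?_
  positivity

/-- Within `1/4` of its zeros `c = 1/4` and `c = 3/4`, the cosine is at least `4|x - c|` in absolute
value. Comparison with an arctangent integral gives `π / (4AB)` on each half. -/
theorem integral_inv_sq_add_sq_cos_le {A B : ℝ} (hA : 0 < A) (hB : 0 < B) :
    ∫ x in (0 : ℝ)..1, (A ^ 2 + (B * Real.cos (2 * Real.pi * x)) ^ 2)⁻¹ ≤
      Real.pi / (2 * (A * B)) := by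
  have hc := continuous_inv_sq_add_sq_cos hA B
  have hc' : ∀ c : ℝ, Continuous fun x : ℝ => (A ^ 2 + (4 * B) ^ 2 * (x - c) ^ 2)⁻¹ := by
    intro c
    refine Continuous.inv₀ (by fun_prop) fun x => ?_
    positivity
  have key : ∀ x c : ℝ, |x - c| ≤ 1 / 4 →
      |Real.cos (2 * Real.pi * x)| = |Real.sin (2 * Real.pi * (x - c))| →
      (A ^ 2 + (B * Real.cos (2 * Real.pi * x)) ^ 2)⁻¹ ≤
        (A ^ 2 + (4 * B) ^ 2 * (x - c) ^ 2)⁻¹ := by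
    intro x c h1 h2
    have h3 := four_mul_abs_le_abs_sin h1
    rw [← h2] at h3
    have h4 : (4 * B) ^ 2 * (x - c) ^ 2 ≤ (B * Real.cos (2 * Real.pi * x)) ^ 2 := by
      rw [← mul_pow]
      refine sq_le_sq.2 ?_
      rw [abs_mul, abs_mul B, abs_of_pos hB, abs_of_pos (by positivity : 0 < 4 * B)]
      nlinarith
    gcongr
  have h1 : ∫ x in (0 : ℝ)..(1 / 2), (A ^ 2 + (B * Real.cos (2 * Real.pi * x)) ^ 2)⁻¹ ≤
      Real.pi / (A * (4 * B)) := by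
    refine (intervalIntegral.integral_mono_on (by norm_num) (hc.intervalIntegrable _ _)
      ((hc' (1 / 4)).intervalIntegrable _ _) fun x hx => ?_).trans
      (integral_inv_sq_add_sq_le hA (by positivity : 0 < 4 * B) _ _ (1 / 4))
    refine key x _ (abs_le.2 ⟨by linarith [hx.1], by linarith [hx.2]⟩) ?_
    rw [show 2 * Real.pi * (x - 1 / 4) = 2 * Real.pi * x - Real.pi / 2 by ring,
      Real.sin_sub_pi_div_two, abs_neg]
  have h2 : ∫ x in (1 / 2 : ℝ)..1, (A ^ 2 + (B * Real.cos (2 * Real.pi * x)) ^ 2)⁻¹ ≤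
      Real.pi / (A * (4 * B)) := by
    refine (intervalIntegral.integral_mono_on (by norm_num) (hc.intervalIntegrable _ _)
      ((hc' (3 / 4)).intervalIntegrable _ _) fun x hx => ?_).trans
      (integral_inv_sq_add_sq_le hA (by positivity : 0 < 4 * B) _ _ (3 / 4))
    refine key x _ (abs_le.2 ⟨by linarith [hx.1], by linarith [hx.2]⟩) ?_
    rw [show 2 * Real.pi * (x - 3 / 4) = 2 * Real.pi * x - Real.pi / 2 - Real.pi by ring,
      Real.sin_sub_pi, Real.sin_sub_pi_div_two, neg_neg]
  rw [← intervalIntegral.integral_add_adjacent_intervals (hc.intervalIntegrable 0 (1 / 2))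
    (hc.intervalIntegrable (1 / 2) 1)]
  refine (add_le_add h1 h2).trans (le_of_eq ?_)
  field_simp
  norm_num

/-! ### Weighted curves and their transport by the standard map -/

/-- A parametrised curve `t ↦ (X t, Y t)` in the plane with a weight `w ≥ 0`. Where `w` does not
vanish, `r` is the slope `Y' / X'` of the curve and `u = w / X'` is the density of the weight with
respect to the abscissa; both are continued to functions of class `C¹` on the whole of `[p, q]`,
with derivatives `dr` and `du`. -/
structure WeightedCurve (L p q : ℝ) where
  X : ℝ → ℝ
  Y : ℝ → ℝ
  dX : ℝ → ℝ
  dY : ℝ → ℝ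
  r : ℝ → ℝ
  dr : ℝ → ℝ
  u : ℝ → ℝ
  du : ℝ → ℝ
  w : ℝ → ℝ
  hasDerivAt_X : ∀ t ∈ Icc p q, HasDerivAt X (dX t) t
  hasDerivAt_Y : ∀ t ∈ Icc p q, HasDerivAt Y (dY t) t
  hasDerivAt_r : ∀ t ∈ Icc p q, HasDerivAt r (dr t) t
  hasDerivAt_u : ∀ t ∈ Icc p q, HasDerivAt u (du t) t
  continuousOn_dX : ContinuousOn dX (Icc p q)
  continuousOn_dY : ContinuousOn dY (Icc p q)
  continuousOn_dr : ContinuousOn dr (Icc p q)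
  continuousOn_du : ContinuousOn du (Icc p q)
  continuousOn_w : ContinuousOn w (Icc p q)
  w_nonneg : ∀ t ∈ Icc p q, 0 ≤ w t
  abs_r_le : ∀ t ∈ Icc p q, |r t| ≤ 1
  u_mul_dX : ∀ t ∈ Icc p q, u t * dX t = w t
  u_mul_slope : ∀ t ∈ Icc p q, u t * (r t * dX t - dY t) = 0
  abs_u_mul_dr_le : ∀ t ∈ Icc p q, |u t * dr t| ≤ L * w t

namespace WeightedCurve

variable {L p q A : ℝ}

/-- The total variation of the density of the weight, including the jumps at the end points. -/
def variation (S : WeightedCurve L p q) : ℝ :=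
  |S.u p| + |S.u q| + ∫ t in p..q, |S.du t|

/-- The derivative of the new abscissa with respect to the old one. -/
def expansion (S : WeightedCurve L p q) (t : ℝ) : ℝ :=
  2 + 2 * Real.pi * L * Real.cos (2 * Real.pi * S.X t) - S.r t

/-- The derivative of `expansion`. -/
def expansionDeriv (S : WeightedCurve L p q) (t : ℝ) : ℝ :=
  -(4 * Real.pi ^ 2 * L * Real.sin (2 * Real.pi * S.X t) * S.dX t) - S.dr t

variable (S : WeightedCurve L p q)

theorem continuousOn_X : ContinuousOn S.X (Icc p q) :=
  fun t ht => (S.hasDerivAt_X t ht).continuousAt.continuousWithinAt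

theorem continuousOn_u : ContinuousOn S.u (Icc p q) :=
  fun t ht => (S.hasDerivAt_u t ht).continuousAt.continuousWithinAt

theorem hasDerivAt_expansion {t : ℝ} (ht : t ∈ Icc p q) :
    HasDerivAt S.expansion (S.expansionDeriv t) t := by
  have h := (((((S.hasDerivAt_X t ht).const_mul (2 * Real.pi)).cos).const_mul
    (2 * Real.pi * L)).const_add 2).sub (S.hasDerivAt_r t ht)
  refine h.congr_deriv ?_
  rw [expansionDeriv]; ring

theorem continuousOn_expansion : ContinuousOn S.expansion (Icc p q) :=
  fun _ ht => (S.hasDerivAt_expansion ht).continuousAt.continuousWithinAt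

theorem continuousOn_expansionDeriv : ContinuousOn S.expansionDeriv (Icc p q) := by
  have h1 := S.continuousOn_X
  have h2 := S.continuousOn_dX
  have h3 := S.continuousOn_dr
  unfold expansionDeriv
  fun_prop

/-- Multiplying by `u` turns `X'` into `w`: the cosine term contributes `4π²L w ≤ 40 L w`, the slope
another `L w`. -/
theorem abs_u_mul_expansionDeriv_le (hL : 0 ≤ L) {t : ℝ} (ht : t ∈ Icc p q) :
    |S.u t * S.expansionDeriv t| ≤ 41 * L * S.w t := by
  have e : S.u t * S.expansionDeriv t =
      -(4 * Real.pi ^ 2 * L * Real.sin (2 * Real.pi * S.X t) * S.w t) - S.u t * S.dr t := by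
    rw [← S.u_mul_dX t ht, expansionDeriv]; ring
  have hw := S.w_nonneg t ht
  have hpi : Real.pi ^ 2 ≤ 10 := by nlinarith [Real.pi_lt_d2, Real.pi_pos]
  have h1 : |4 * Real.pi ^ 2 * L * Real.sin (2 * Real.pi * S.X t) * S.w t| ≤ 40 * L * S.w t := by
    rw [abs_mul, abs_mul, abs_of_nonneg hw, abs_of_nonneg (by positivity : 0 ≤ 4 * Real.pi ^ 2 * L)]
    calc 4 * Real.pi ^ 2 * L * |Real.sin (2 * Real.pi * S.X t)| * S.w t
        ≤ 4 * 10 * L * 1 * S.w t := by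
          gcongr
          exact Real.abs_sin_le_one _
      _ = 40 * L * S.w t := by ring
  rw [e]
  refine (abs_sub _ _).trans ?_
  rw [abs_neg]
  linarith [S.abs_u_mul_dr_le t ht]

/-- The image of a weighted curve under a lift of the standard map. The weight is multiplied by a
cutoff that vanishes where the expansion is at most `A`. -/
def step (S : WeightedCurve L p q) (hL : 0 ≤ L) (hA : 4 ≤ A) : WeightedCurve L p q where
  X t := 2 * S.X t - S.Y t + L * Real.sin (2 * Real.pi * S.X t)
  Y := S.X
  dX t := (2 + 2 * Real.pi * L * Real.cos (2 * Real.pi * S.X t)) * S.dX t - S.dY t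
  dY := S.dX
  r t := extInv A (S.expansion t)
  dr t := extInvDeriv A (S.expansion t) * S.expansionDeriv t
  u t := S.u t * cutInv A (S.expansion t)
  du t := S.du t * cutInv A (S.expansion t) +
    S.u t * (cutInvDeriv A (S.expansion t) * S.expansionDeriv t)
  w t := S.w t * (S.expansion t * cutInv A (S.expansion t))
  hasDerivAt_X t ht := by
    have h := (((S.hasDerivAt_X t ht).const_mul 2).sub (S.hasDerivAt_Y t ht)).add
      ((((S.hasDerivAt_X t ht).const_mul (2 * Real.pi)).sin).const_mul L)
    exact h.congr_deriv (by ring)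
  hasDerivAt_Y := S.hasDerivAt_X
  hasDerivAt_r t ht := (hasDerivAt_extInv (by linarith) _).comp t (S.hasDerivAt_expansion ht)
  hasDerivAt_u t ht := (S.hasDerivAt_u t ht).mul
    ((hasDerivAt_cutInv (by linarith) _).comp t (S.hasDerivAt_expansion ht))
  continuousOn_dX := by
    have h1 := S.continuousOn_X
    have h2 := S.continuousOn_dX
    have h3 := S.continuousOn_dY
    fun_prop
  continuousOn_dY := S.continuousOn_dX
  continuousOn_dr := ((continuous_extInvDeriv (by linarith)).comp_continuousOn
    S.continuousOn_expansion).mul S.continuousOn_expansionDeriv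
  continuousOn_du := by
    have hc : Continuous (cutInv A) := continuous_iff_continuousAt.2 fun a =>
      (hasDerivAt_cutInv (by linarith) a).continuousAt
    exact (S.continuousOn_du.mul (hc.comp_continuousOn S.continuousOn_expansion)).add
      (S.continuousOn_u.mul (((continuous_cutInvDeriv (by linarith)).comp_continuousOn
        S.continuousOn_expansion).mul S.continuousOn_expansionDeriv))
  continuousOn_w := by
    have hc : Continuous (cutInv A) := continuous_iff_continuousAt.2 fun a =>
      (hasDerivAt_cutInv (by linarith) a).continuousAt
    exact S.continuousOn_w.mul (S.continuousOn_expansion.mul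
      (hc.comp_continuousOn S.continuousOn_expansion))
  w_nonneg t ht := mul_nonneg (S.w_nonneg t ht) (mul_cutInv_nonneg (by linarith) _)
  abs_r_le t ht := (abs_extInv_le (by linarith) _).trans
    ((div_le_one (by linarith)).2 (by linarith))
  u_mul_dX t ht := by
    have h1 := S.u_mul_slope t ht
    rw [← S.u_mul_dX t ht]
    simp only [expansion] at *
    -- The old slope relation replaces `Y'` by `r X'`, so the new `X'` is the expansion times the
    -- old one.
    linear_combination cutInv A (2 + 2 * Real.pi * L * Real.cos (2 * Real.pi * S.X t) - S.r t) * h1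
  u_mul_slope t ht := by
    have h1 := S.u_mul_slope t ht
    have h2 := cutInv_mul_extInv (show 0 < A by linarith) (S.expansion t)
    have h3 : S.u t * ((2 + 2 * Real.pi * L * Real.cos (2 * Real.pi * S.X t)) * S.dX t - S.dY t) =
        S.u t * (S.expansion t * S.dX t) := by
      rw [expansion]; linear_combination h1
    linear_combination S.u t * S.dX t * h2 +
      cutInv A (S.expansion t) * extInv A (S.expansion t) * h3
  abs_u_mul_dr_le t ht := by
    have hA0 : 0 < A := by linarith
    have h1 := S.abs_u_mul_expansionDeriv_le hL ht
    have h2 := abs_cutInv_mul_extInvDeriv_le hA0 (S.expansion t)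
    have hw := S.w_nonneg t ht
    have hc := mul_cutInv_nonneg hA0 (S.expansion t)
    -- The curvature bound reproduces itself because `41 ≤ 4³`; this is where `4 ≤ A` is needed.
    have h3 : 41 * (A ^ 3)⁻¹ ≤ 1 := by
      rw [← div_eq_mul_inv, div_le_one (by positivity)]
      calc (41 : ℝ) ≤ 4 ^ 3 := by norm_num
        _ ≤ A ^ 3 := by gcongr
    calc |S.u t * cutInv A (S.expansion t) *
          (extInvDeriv A (S.expansion t) * S.expansionDeriv t)|
        = |S.u t * S.expansionDeriv t| *
          |cutInv A (S.expansion t) * extInvDeriv A (S.expansion t)| := by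
          rw [← abs_mul]; congr 1; ring
      _ ≤ (41 * L * S.w t) * (S.expansion t * cutInv A (S.expansion t) * (A ^ 3)⁻¹) := by gcongr
      _ = L * (S.w t * (S.expansion t * cutInv A (S.expansion t))) * (41 * (A ^ 3)⁻¹) := by ring
      _ ≤ L * (S.w t * (S.expansion t * cutInv A (S.expansion t))) :=
          mul_le_of_le_one_right (by positivity) h3

theorem step_w_le (hL : 0 ≤ L) (hA : 4 ≤ A) {t : ℝ} (ht : t ∈ Icc p q) :
    (S.step hL hA).w t ≤ S.w t :=
  mul_le_of_le_one_right (S.w_nonneg t ht) (mul_cutInv_le_one (by linarith) _)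

theorem variation_nonneg (hpq : p ≤ q) : 0 ≤ S.variation := by
  have := intervalIntegral.integral_nonneg (f := fun t => |S.du t|) (μ := volume) hpq
    fun t _ => abs_nonneg _
  rw [variation]; positivity

theorem continuousOn_w_mul {f : ℝ → ℝ} (hf : Continuous f) :
    ContinuousOn (fun t => S.w t * f (S.X t)) (Icc p q) :=
  S.continuousOn_w.mul (hf.comp_continuousOn S.continuousOn_X)

theorem intervalIntegrable_w_mul (hpq : p ≤ q) {f : ℝ → ℝ} (hf : Continuous f) :
    IntervalIntegrable (fun t => S.w t * f (S.X t)) volume p q :=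
  (S.continuousOn_w_mul hf).intervalIntegrable_of_Icc hpq

theorem intervalIntegrable_w (hpq : p ≤ q) : IntervalIntegrable S.w volume p q :=
  S.continuousOn_w.intervalIntegrable_of_Icc hpq

/-- The abscissa of a weighted curve is equidistributed up to the variation of the density. -/
theorem abs_integral_w_mul_le (hpq : p ≤ q) {f : ℝ → ℝ} (hf : Continuous f)
    (hp : Function.Periodic f 1) (h0 : ∫ t in (0 : ℝ)..1, f t = 0) :
    |∫ t in p..q, S.w t * f (S.X t)| ≤ (∫ t in (0 : ℝ)..1, |f t|) * S.variation := by
  set I := ∫ t in (0 : ℝ)..1, |f t| with hI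
  set G : ℝ → ℝ := fun x => ∫ t in (0 : ℝ)..x, f t with hG
  have hGI : ∀ x, |G x| ≤ I := abs_primitive_le_of_periodic hf hp h0
  have hGd : ∀ x, HasDerivAt G (f x) x := fun x =>
    intervalIntegral.integral_hasDerivAt_right (hf.intervalIntegrable 0 x)
      (hf.stronglyMeasurableAtFilter _ _) hf.continuousAt
  have hGc : Continuous G := continuous_iff_continuousAt.2 fun x => (hGd x).continuousAt
  have hu : uIcc p q = Icc p q := uIcc_of_le hpq
  have hdu : IntervalIntegrable S.du volume p q :=
    S.continuousOn_du.intervalIntegrable_of_Icc hpq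
  -- No monotonicity of `X` is needed: the bounded function `G ∘ X` is a primitive of `f(X) X'`, and
  -- the derivative moves to `u`.
  have hparts := intervalIntegral.integral_mul_deriv_eq_deriv_mul (a := p) (b := q) (u := S.u)
    (v := fun t => G (S.X t)) (u' := S.du) (v' := fun t => f (S.X t) * S.dX t)
    (fun t ht => S.hasDerivAt_u t (hu ▸ ht))
    (fun t ht => (hGd (S.X t)).comp t (S.hasDerivAt_X t (hu ▸ ht)))
    hdu
    (((hf.comp_continuousOn S.continuousOn_X).mul S.continuousOn_dX).intervalIntegrable_of_Icc hpq)
  have e : ∫ t in p..q, S.w t * f (S.X t) = ∫ t in p..q, S.u t * (f (S.X t) * S.dX t) := by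
    refine intervalIntegral.integral_congr fun t ht => ?_
    rw [← S.u_mul_dX t (hu ▸ ht)]; ring
  have hint : |∫ t in p..q, S.du t * G (S.X t)| ≤ I * ∫ t in p..q, |S.du t| := by
    refine (intervalIntegral.abs_integral_le_integral_abs hpq).trans ?_
    rw [← intervalIntegral.integral_const_mul]
    refine intervalIntegral.integral_mono_on hpq
      ((S.continuousOn_du.mul (hGc.comp_continuousOn
        S.continuousOn_X)).abs.intervalIntegrable_of_Icc hpq) (hdu.abs.const_mul I) fun t ht => ?_
    rw [abs_mul, mul_comm]
    exact mul_le_mul_of_nonneg_right (hGI _) (abs_nonneg _)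
  have hq : |S.u q * G (S.X q)| ≤ I * |S.u q| := by
    rw [abs_mul, mul_comm]; exact mul_le_mul_of_nonneg_right (hGI _) (abs_nonneg _)
  have hp' : |S.u p * G (S.X p)| ≤ I * |S.u p| := by
    rw [abs_mul, mul_comm]; exact mul_le_mul_of_nonneg_right (hGI _) (abs_nonneg _)
  rw [e, hparts, variation]
  refine (abs_sub _ _).trans ?_
  have := abs_sub (S.u q * G (S.X q)) (S.u p * G (S.X p))
  linarith

/-- Split `f` into its mean `I` and `f - I`, whose `L¹` norm is at most `2I`. The bound depends only
on `∫ f`, so tall narrow peaks are allowed. -/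
theorem integral_w_mul_le (hpq : p ≤ q) (hm : ∫ t in p..q, S.w t ≤ 1) {f : ℝ → ℝ}
    (hf : Continuous f) (hp : Function.Periodic f 1) (hf0 : ∀ x, 0 ≤ f x) :
    ∫ t in p..q, S.w t * f (S.X t) ≤ (∫ t in (0 : ℝ)..1, f t) * (1 + 2 * S.variation) := by
  set I := ∫ t in (0 : ℝ)..1, f t with hI
  have hI0 : 0 ≤ I := intervalIntegral.integral_nonneg zero_le_one fun t _ => hf0 t
  have h := S.abs_integral_w_mul_le hpq (f := fun x => f x - I) (hf.sub continuous_const)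
    (fun x => by simp only [hp x])
    (by rw [intervalIntegral.integral_sub (hf.intervalIntegrable _ _)
          intervalIntegrable_const]; simp [← hI])
  have habs : ∫ t in (0 : ℝ)..1, |f t - I| ≤ 2 * I := by
    have h1 : ∫ t in (0 : ℝ)..1, |f t - I| ≤ ∫ t in (0 : ℝ)..1, (f t + I) := by
      refine intervalIntegral.integral_mono_on zero_le_one
        ((hf.sub continuous_const).abs.intervalIntegrable _ _)
        ((hf.add continuous_const).intervalIntegrable _ _) fun t _ => ?_
      refine (abs_sub _ _).trans ?_
      rw [abs_of_nonneg (hf0 t), abs_of_nonneg hI0]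
    rw [intervalIntegral.integral_add (hf.intervalIntegrable _ _) intervalIntegrable_const] at h1
    simp only [intervalIntegral.integral_const, sub_zero, one_smul, ← hI] at h1
    linarith
  have e : ∫ t in p..q, S.w t * (f (S.X t) - I) =
      (∫ t in p..q, S.w t * f (S.X t)) - (∫ t in p..q, S.w t) * I := by
    rw [← intervalIntegral.integral_mul_const, ← intervalIntegral.integral_sub
      (S.intervalIntegrable_w_mul hpq hf) ((S.intervalIntegrable_w hpq).mul_const I)]
    simp only [mul_sub]
  rw [e] at h
  have h2 := (abs_le.1 h).2
  have h3 := mul_le_mul_of_nonneg_right habs (S.variation_nonneg hpq)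
  have h4 := mul_le_mul_of_nonneg_right hm hI0
  linarith

/-! ### Variation and mass after one step. -/

/-- The slope is removed so that the bound depends on `X` alone. The expansion differs from the
cosine term by at most `3`, whence `18 = 2 · 3²`, absorbed since `18 ≤ A²`. -/
theorem inv_max_expansion_sq_le (hA : 5 ≤ A) {t : ℝ} (ht : t ∈ Icc p q) :
    (max (S.expansion t ^ 2) (A ^ 2))⁻¹ ≤
      4 * (A ^ 2 + (2 * Real.pi * L * Real.cos (2 * Real.pi * S.X t)) ^ 2)⁻¹ := by
  have hr := abs_le.1 (S.abs_r_le t ht)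
  set z := 2 * Real.pi * L * Real.cos (2 * Real.pi * S.X t) with hz
  have e : S.expansion t = z + (2 - S.r t) := by rw [expansion]; ring
  have hA0 : 0 < A ^ 2 := by positivity
  have h1 : z ^ 2 ≤ 2 * S.expansion t ^ 2 + 18 := by
    rw [e]; nlinarith [sq_nonneg (z + 2 * (2 - S.r t))]
  have h2 := le_max_left (S.expansion t ^ 2) (A ^ 2)
  have h3 := le_max_right (S.expansion t ^ 2) (A ^ 2)
  have h4 := max_sq_pos (show 0 < A by linarith) (S.expansion t)
  rw [← div_eq_mul_inv, inv_eq_one_div, div_le_div_iff₀ h4 (by positivity)]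
  nlinarith

theorem integral_w_mul_inv_le (hL : 0 < L) (hA : 5 ≤ A) (hpq : p ≤ q)
    (hm : ∫ t in p..q, S.w t ≤ 1) :
    ∫ t in p..q, S.w t *
      (4 * (A ^ 2 + (2 * Real.pi * L * Real.cos (2 * Real.pi * S.X t)) ^ 2)⁻¹) ≤
      (A * L)⁻¹ * (1 + 2 * S.variation) := by
  have hA0 : 0 < A := by linarith
  have hpi := Real.pi_pos
  have hc := continuous_inv_sq_add_sq_cos hA0 (2 * Real.pi * L)
  have h := S.integral_w_mul_le hpq hm hc
    (fun x => by
      have : Real.cos (2 * Real.pi * (x + 1)) = Real.cos (2 * Real.pi * x) := by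
        rw [mul_add, mul_one, Real.cos_add_two_pi]
      simp only [this])
    (fun x => by positivity)
  have hI := integral_inv_sq_add_sq_cos_le hA0 (by positivity : 0 < 2 * Real.pi * L)
  have e : Real.pi / (2 * (A * (2 * Real.pi * L))) = (A * L)⁻¹ / 4 := by
    field_simp
    norm_num
  rw [e] at hI
  have hV := S.variation_nonneg hpq
  simp only [mul_left_comm _ (4 : ℝ)]
  rw [intervalIntegral.integral_const_mul]
  have := mul_le_mul_of_nonneg_right hI (by linarith : 0 ≤ 1 + 2 * S.variation)
  linarith

/-- The old variation is multiplied by at most `1/A`. Differentiating the cutoff adds at most `41 L`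
times the kernel integral, that is `41(1 + 2V) / A`, and `83 = 1 + 2 · 41`. -/
theorem variation_step_le (hL : 0 < L) (hA : 5 ≤ A) (hpq : p ≤ q)
    (hm : ∫ t in p..q, S.w t ≤ 1) :
    (S.step hL.le (by linarith : 4 ≤ A)).variation ≤ (41 + 83 * S.variation) / A := by
  have hA0 : 0 < A := by linarith
  have hc := continuous_inv_sq_add_sq_cos hA0 (2 * Real.pi * L)
  have hdu : IntervalIntegrable S.du volume p q :=
    S.continuousOn_du.intervalIntegrable_of_Icc hpq
  have hW := S.intervalIntegrable_w_mul hpq (hc.const_mul 4)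
  have hend : ∀ t, |(S.step hL.le (by linarith : 4 ≤ A)).u t| ≤ |S.u t| * A⁻¹ := fun t => by
    change |S.u t * cutInv A (S.expansion t)| ≤ _
    rw [abs_mul]
    gcongr
    exact abs_cutInv_le hA0 _
  have hint : ∫ t in p..q, |(S.step hL.le (by linarith : 4 ≤ A)).du t| ≤
      ∫ t in p..q, (|S.du t| * A⁻¹ + 41 * L * (S.w t *
      (4 * (A ^ 2 + (2 * Real.pi * L * Real.cos (2 * Real.pi * S.X t)) ^ 2)⁻¹))) := by
    refine intervalIntegral.integral_mono_on hpq
      ((S.step hL.le (by linarith : 4 ≤ A)).continuousOn_du.abs.intervalIntegrable_of_Icc hpq)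
      ((hdu.abs.mul_const _).add (hW.const_mul _)) fun t ht => ?_
    change |S.du t * cutInv A (S.expansion t) +
      S.u t * (cutInvDeriv A (S.expansion t) * S.expansionDeriv t)| ≤ _
    refine (abs_add_le _ _).trans (add_le_add ?_ ?_)
    · rw [abs_mul]
      gcongr
      exact abs_cutInv_le hA0 _
    · have h1 := S.abs_u_mul_expansionDeriv_le hL.le ht
      have h2 := (abs_cutInvDeriv_le hA0 _).trans (S.inv_max_expansion_sq_le hA ht)
      have hw := S.w_nonneg t ht
      calc |S.u t * (cutInvDeriv A (S.expansion t) * S.expansionDeriv t)|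
          = |S.u t * S.expansionDeriv t| * |cutInvDeriv A (S.expansion t)| := by
            rw [← abs_mul]; congr 1; ring
        _ ≤ (41 * L * S.w t) *
            (4 * (A ^ 2 + (2 * Real.pi * L * Real.cos (2 * Real.pi * S.X t)) ^ 2)⁻¹) := by gcongr
        _ = _ := by ring
  rw [intervalIntegral.integral_add (hdu.abs.mul_const _) (hW.const_mul _),
    intervalIntegral.integral_mul_const, intervalIntegral.integral_const_mul] at hint
  have hK := S.integral_w_mul_inv_le hL hA hpq hm
  have hK2 := mul_le_mul_of_nonneg_left hK (by positivity : 0 ≤ 41 * L)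
  have e : 41 * L * ((A * L)⁻¹ * (1 + 2 * S.variation)) =
      41 * (1 + 2 * S.variation) * A⁻¹ := by field_simp
  rw [e] at hK2
  have h1 := hend p
  have h2 := hend q
  have e2 : (41 + 83 * S.variation) / A =
      (|S.u p| + |S.u q| + ∫ t in p..q, |S.du t|) * A⁻¹ + 41 * (1 + 2 * S.variation) * A⁻¹ := by
    rw [← variation]; ring
  rw [e2, variation]
  linarith

theorem integral_w_sub_step_le (hL : 0 < L) (hA : 5 ≤ A) (hpq : p ≤ q)
    (hm : ∫ t in p..q, S.w t ≤ 1) :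
    (∫ t in p..q, S.w t) - ∫ t in p..q, (S.step hL.le (by linarith : 4 ≤ A)).w t ≤
      2 * (A / L) * (1 + 2 * S.variation) := by
  have hA0 : 0 < A := by linarith
  have hc := continuous_inv_sq_add_sq_cos hA0 (2 * Real.pi * L)
  have hW := S.intervalIntegrable_w_mul hpq (hc.const_mul 4)
  have h1 := S.intervalIntegrable_w hpq
  have h2 := (S.step hL.le (by linarith : 4 ≤ A)).intervalIntegrable_w hpq
  rw [← intervalIntegral.integral_sub h1 h2]
  have hmono := intervalIntegral.integral_mono_on hpq (h1.sub h2)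
    (hW.const_mul (2 * A ^ 2)) fun t ht => by
      change S.w t - S.w t * (S.expansion t * cutInv A (S.expansion t)) ≤ _
      have h3 := one_sub_mul_cutInv_le hA0 (S.expansion t)
      have h4 := mul_le_mul_of_nonneg_left (S.inv_max_expansion_sq_le hA ht)
        (by positivity : 0 ≤ 2 * A ^ 2)
      have h5 := mul_le_mul_of_nonneg_left (h3.trans h4) (S.w_nonneg t ht)
      linarith
  rw [intervalIntegral.integral_const_mul] at hmono
  have hK := mul_le_mul_of_nonneg_left (S.integral_w_mul_inv_le hL hA hpq hm)
    (by positivity : 0 ≤ 2 * A ^ 2)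
  have e : 2 * A ^ 2 * ((A * L)⁻¹ * (1 + 2 * S.variation)) =
      2 * (A / L) * (1 + 2 * S.variation) := by field_simp
  linarith

/-! ### Iteration and equidistribution of the images. -/

/-- The projection of a weighted curve to the torus. -/
def proj (t : ℝ) : Torus := ((S.X t : UnitAddCircle), (S.Y t : UnitAddCircle))

/-- The cutoff alters weights, not points, so orbits are followed exactly whatever the threshold. -/
theorem F_proj (hL : 0 ≤ L) (hA : 4 ≤ A) (t : ℝ) :
    F L (S.proj t) = (S.step hL hA).proj t := by
  have h : sinTwoPi (S.X t : UnitAddCircle) = Real.sin (2 * Real.pi * S.X t) :=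
    Function.Periodic.lift_coe _ _
  simp only [F, proj, step, h, AddCircle.coe_add, AddCircle.coe_sub, two_mul, two_nsmul]

/-- The `k`-th image of a weighted curve. -/
def iter (hL : 0 ≤ L) (hA : 4 ≤ A) (k : ℕ) : WeightedCurve L p q :=
  (fun T : WeightedCurve L p q => T.step hL hA)^[k] S

theorem iter_succ (hL : 0 ≤ L) (hA : 4 ≤ A) (k : ℕ) :
    S.iter hL hA (k + 1) = (S.iter hL hA k).step hL hA :=
  Function.iterate_succ_apply' _ _ _

theorem F_iterate_proj (hL : 0 ≤ L) (hA : 4 ≤ A) (k : ℕ) (t : ℝ) :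
    (F L)^[k] (S.proj t) = (S.iter hL hA k).proj t := by
  induction k with
  | zero => rfl
  | succ k ih => rw [Function.iterate_succ_apply', ih, F_proj _ hL hA, iter_succ]

theorem iter_w_le (hL : 0 ≤ L) (hA : 4 ≤ A) (k : ℕ) {t : ℝ} (ht : t ∈ Icc p q) :
    (S.iter hL hA k).w t ≤ S.w t := by
  induction k with
  | zero => exact le_rfl
  | succ k ih => rw [iter_succ]; exact (step_w_le _ hL hA ht).trans ih

theorem integral_iter_w_le (hL : 0 ≤ L) (hA : 4 ≤ A) (hpq : p ≤ q) (k : ℕ) :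
    ∫ t in p..q, (S.iter hL hA k).w t ≤ ∫ t in p..q, S.w t :=
  intervalIntegral.integral_mono_on hpq (intervalIntegrable_w _ hpq) (S.intervalIntegrable_w hpq)
    fun _ ht => S.iter_w_le hL hA k ht

/-- For `1 ≤ B`, `41 + 83B ≤ 124B ≤ AB`, so the bound `B` is preserved. -/
theorem variation_iter_le (hL : 0 < L) (hA : 124 ≤ A) (hpq : p ≤ q)
    (hm : ∫ t in p..q, S.w t ≤ 1) {B : ℝ} (hB : 1 ≤ B) (hS : S.variation ≤ B) (k : ℕ) :
    (S.iter hL.le (by linarith : 4 ≤ A) k).variation ≤ B := by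
  induction k with
  | zero => exact hS
  | succ k ih =>
    rw [iter_succ]
    refine (variation_step_le _ hL (by linarith) hpq
      ((S.integral_iter_w_le _ _ hpq k).trans hm)).trans ?_
    rw [div_le_iff₀ (by linarith)]
    nlinarith

theorem integral_w_sub_iter_le (hL : 0 < L) (hA : 124 ≤ A) (hpq : p ≤ q)
    (hm : ∫ t in p..q, S.w t ≤ 1) {B : ℝ} (hB : 1 ≤ B) (hS : S.variation ≤ B) (k : ℕ) :
    (∫ t in p..q, S.w t) - ∫ t in p..q, (S.iter hL.le (by linarith : 4 ≤ A) k).w t ≤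
      k * (2 * (A / L) * (1 + 2 * B)) := by
  induction k with
  | zero => simp [iter]
  | succ k ih =>
    have hV := S.variation_iter_le hL hA hpq hm hB hS k
    have h := integral_w_sub_step_le (S.iter hL.le (by linarith : 4 ≤ A) k) hL
      (by linarith : 5 ≤ A) hpq ((S.integral_iter_w_le _ _ hpq k).trans hm)
    have h2 : 2 * (A / L) * (1 + 2 * (S.iter hL.le (by linarith : 4 ≤ A) k).variation) ≤
        2 * (A / L) * (1 + 2 * B) := by
      have : 0 < A := by linarith
      gcongr
    rw [iter_succ]
    push_cast
    linarith

/-- Equidistribution of the abscissa of the `(k + 1)`-st image of a weighted curve. -/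
theorem abs_integral_w_mul_iter_le {A' : ℝ} (hL : 0 < L) (hA : 124 ≤ A) (hA' : 5 ≤ A')
    (hpq : p ≤ q) (hm : ∫ t in p..q, S.w t ≤ 1) {B : ℝ} (hB : 1 ≤ B) (hS : S.variation ≤ B)
    {f : ℝ → ℝ} (hf : Continuous f) (hp : Function.Periodic f 1)
    (h0 : ∫ t in (0 : ℝ)..1, f t = 0) {N : ℝ} (hN : ∀ x, |f x| ≤ N) (k : ℕ) :
    |∫ t in p..q, S.w t * f (((S.iter hL.le (by linarith : 4 ≤ A) k).step hL.le
        (by linarith : 4 ≤ A')).X t)| ≤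
      N * (k * (2 * (A / L) * (1 + 2 * B)) + 2 * (A' / L) * (1 + 2 * B) +
        (41 + 83 * B) / A') := by
  set R := S.iter hL.le (by linarith : 4 ≤ A) k with hR
  set T := R.step hL.le (by linarith : 4 ≤ A') with hT
  have hA0 : 0 < A' := by linarith
  have hN0 : 0 ≤ N := (abs_nonneg _).trans (hN 0)
  have hmR : ∫ t in p..q, R.w t ≤ 1 := (S.integral_iter_w_le _ _ hpq k).trans hm
  have hV : R.variation ≤ B := S.variation_iter_le hL hA hpq hm hB hS k
  have hVT : T.variation ≤ (41 + 83 * B) / A' :=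
    (R.variation_step_le hL hA' hpq hmR).trans (by gcongr)
  have hloss1 := S.integral_w_sub_iter_le hL hA hpq hm hB hS k
  have hloss2 : (∫ t in p..q, R.w t) - ∫ t in p..q, T.w t ≤ 2 * (A' / L) * (1 + 2 * B) :=
    (R.integral_w_sub_step_le hL hA' hpq hmR).trans (by gcongr)
  have hmain := T.abs_integral_w_mul_le hpq hf hp h0
  have hfN : ∫ t in (0 : ℝ)..1, |f t| ≤ N := by
    have := intervalIntegral.integral_mono_on (zero_le_one' ℝ) (hf.abs.intervalIntegrable 0 1)
      (intervalIntegrable_const (μ := volume) (c := N)) fun t _ => hN t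
    simpa using this
  have hmain2 : |∫ t in p..q, T.w t * f (T.X t)| ≤ N * ((41 + 83 * B) / A') :=
    hmain.trans (mul_le_mul hfN hVT (T.variation_nonneg hpq) hN0)
  have hSf : IntervalIntegrable (fun t => S.w t * f (T.X t)) volume p q :=
    (S.continuousOn_w.mul (hf.comp_continuousOn T.continuousOn_X)).intervalIntegrable_of_Icc hpq
  have hTf := T.intervalIntegrable_w_mul hpq hf
  have hSw := S.intervalIntegrable_w hpq
  have hTw := T.intervalIntegrable_w hpq
  -- Weights only decrease, so restoring the initial weight costs `N` times the total mass lost.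
  have hdiff : |∫ t in p..q, (S.w t * f (T.X t) - T.w t * f (T.X t))| ≤
      ∫ t in p..q, N * (S.w t - T.w t) := by
    refine (intervalIntegral.abs_integral_le_integral_abs hpq).trans ?_
    refine intervalIntegral.integral_mono_on hpq (hSf.sub hTf).abs
      ((hSw.sub hTw).const_mul N) fun t ht => ?_
    have hle : T.w t ≤ S.w t := (R.step_w_le _ _ ht).trans (S.iter_w_le _ _ k ht)
    rw [← sub_mul, abs_mul, abs_of_nonneg (sub_nonneg.2 hle), mul_comm]
    exact mul_le_mul_of_nonneg_right (hN _) (sub_nonneg.2 hle)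
  rw [intervalIntegral.integral_const_mul, intervalIntegral.integral_sub hSw hTw,
    intervalIntegral.integral_sub hSf hTf] at hdiff
  have hdiff2 : N * ((∫ t in p..q, S.w t) - ∫ t in p..q, T.w t) ≤
      N * (k * (2 * (A / L) * (1 + 2 * B)) + 2 * (A' / L) * (1 + 2 * B)) := by
    gcongr
    linarith
  have habs := abs_sub_abs_le_abs_sub (∫ t in p..q, S.w t * f (T.X t))
    (∫ t in p..q, T.w t * f (T.X t))
  linarith

end WeightedCurve

/-! ### Densities with bounded logarithmic derivative -/

section Density

variable {ρ : ℝ → ℝ} {K : ℝ}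

theorem abs_deriv_le_of_abs_deriv_log_le {x : ℝ} (hρ : DifferentiableAt ℝ ρ x) (hpos : 0 < ρ x)
    (hlog : |deriv (fun t => Real.log (ρ t)) x| ≤ K) : |deriv ρ x| ≤ K * ρ x := by
  rw [(hρ.hasDerivAt.log hpos.ne').deriv, abs_div, abs_of_pos hpos, div_le_iff₀ hpos] at hlog
  exact hlog

/-- Values of `ρ` at two points differ by a factor at most `exp K`; average over the second point.
-/
theorem le_exp_of_abs_deriv_log_le (hK : 0 ≤ K) (hpos : ∀ x ∈ Ioo (0 : ℝ) 1, 0 < ρ x)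
    (hdiff : ∀ x ∈ Ioo (0 : ℝ) 1, DifferentiableAt ℝ ρ x)
    (hint : ∫ x in Ioo (0 : ℝ) 1, ρ x = 1)
    (hlog : ∀ x ∈ Ioo (0 : ℝ) 1, |deriv (fun t => Real.log (ρ t)) x| ≤ K)
    {x : ℝ} (hx : x ∈ Ioo (0 : ℝ) 1) : ρ x ≤ Real.exp K := by
  -- A non-integrable function would have integral `0` by convention, not `1`.
  have hI : IntegrableOn ρ (Ioo 0 1) :=
    not_imp_comm.1 integral_undef (by rw [hint]; exact one_ne_zero)
  have h : ∀ t ∈ Ioo (0 : ℝ) 1, ρ x ≤ Real.exp K * ρ t := by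
    intro t ht
    have h1 := Convex.norm_image_sub_le_of_norm_deriv_le (𝕜 := ℝ)
      (f := fun t => Real.log (ρ t)) (fun y hy => (hdiff y hy).log (hpos y hy).ne') hlog
      (convex_Ioo 0 1) ht hx
    have h2 : ‖x - t‖ ≤ 1 := abs_le.2 ⟨by linarith [hx.1, ht.2], by linarith [hx.2, ht.1]⟩
    have h3 := (le_abs_self _).trans (h1.trans (mul_le_of_le_one_right hK h2))
    calc ρ x = Real.exp (Real.log (ρ x)) := (Real.exp_log (hpos x hx)).symm
      _ ≤ Real.exp (K + Real.log (ρ t)) := Real.exp_le_exp.2 (by linarith)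
      _ = Real.exp K * ρ t := by rw [Real.exp_add, Real.exp_log (hpos t ht)]
  have h2 := setIntegral_mono_on (integrableOn_const (by simp)) (hI.const_mul (Real.exp K))
    measurableSet_Ioo h
  rw [integral_const_mul, hint] at h2
  simpa using h2

end Density

/-- The weighted curve given by a graph over `[p, q] ⊂ (0, 1)` and a density. -/
def WeightedCurve.ofGraph {L p q : ℝ} (hp : 0 < p) (hq : q < 1) (H ρ : ℝ → ℝ)
    (hH : ContDiffOn ℝ 2 H (Ioo 0 1)) (hH1 : ∀ x ∈ Ioo (0 : ℝ) 1, |deriv H x| ≤ 1 / 10)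
    (hH2 : ∀ x ∈ Ioo (0 : ℝ) 1, |deriv (deriv H) x| ≤ L)
    (hρ : ContDiffOn ℝ 1 ρ (Ioo 0 1)) (hpos : ∀ x ∈ Ioo (0 : ℝ) 1, 0 < ρ x) :
    WeightedCurve L p q :=
  have hsub : Icc p q ⊆ Ioo 0 1 := Icc_subset_Ioo hp hq
  have hH' : ContDiffOn ℝ 1 (deriv H) (Ioo 0 1) := hH.deriv_of_isOpen isOpen_Ioo (by norm_num)
  have hd : ∀ {g : ℝ → ℝ} {n : WithTop ℕ∞}, n ≠ 0 → ContDiffOn ℝ n g (Ioo 0 1) →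
      ∀ t ∈ Icc p q, HasDerivAt g (deriv g t) t := fun hn hg t ht =>
    ((hg.differentiableOn hn).differentiableAt (isOpen_Ioo.mem_nhds (hsub ht))).hasDerivAt
  { X := id
    Y := H
    dX := fun _ => 1
    dY := deriv H
    r := deriv H
    dr := deriv (deriv H)
    u := ρ
    du := deriv ρ
    w := ρ
    hasDerivAt_X := fun t _ => hasDerivAt_id t
    hasDerivAt_Y := hd two_ne_zero hH
    hasDerivAt_r := hd one_ne_zero hH'
    hasDerivAt_u := hd one_ne_zero hρ
    continuousOn_dX := continuousOn_const
    continuousOn_dY := hH'.continuousOn.mono hsub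
    continuousOn_dr := (hH'.continuousOn_deriv_of_isOpen isOpen_Ioo le_rfl).mono hsub
    continuousOn_du := (hρ.continuousOn_deriv_of_isOpen isOpen_Ioo le_rfl).mono hsub
    continuousOn_w := hρ.continuousOn.mono hsub
    w_nonneg := fun t ht => (hpos t (hsub ht)).le
    abs_r_le := fun t ht => (hH1 t (hsub ht)).trans (by norm_num)
    u_mul_dX := fun t _ => mul_one _
    u_mul_slope := fun t _ => by ring
    abs_u_mul_dr_le := fun t ht => by
      rw [abs_mul, abs_of_pos (hpos t (hsub ht)), mul_comm]
      exact mul_le_mul_of_nonneg_right (hH2 t (hsub ht)) (hpos t (hsub ht)).le }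

/-! ### From measure pairs on the torus to weighted curves. -/

theorem continuous_sinTwoPi : Continuous sinTwoPi := by
  refine continuous_coinduced_dom.2 ?_
  change Continuous fun x : ℝ => Real.sin (2 * Real.pi * x)
  fun_prop

theorem continuous_F (L : ℝ) : Continuous (F L) := by
  have h1 := continuous_sinTwoPi
  have h2 : Continuous ((↑) : ℝ → UnitAddCircle) := AddCircle.continuous_mk' 1
  unfold F
  simp only [two_nsmul]
  refine Continuous.prodMk (((continuous_fst.add continuous_fst).sub continuous_snd).add
    (h2.comp ?_)) continuous_fst
  exact continuous_const.mul (h1.comp continuous_fst)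

theorem MeasurePair.aemeasurable_param {L : ℝ} (P : MeasurePair L) :
    AEMeasurable P.γ.param (volume.restrict P.γ.interval) := by
  obtain ⟨H, hH, hC, -⟩ := P.γ.exists_lift
  have hco : Continuous ((↑) : ℝ → UnitAddCircle) := AddCircle.continuous_mk' 1
  have h1 : AEMeasurable (fun x : ℝ => (((x : UnitAddCircle), (H x : UnitAddCircle)) : Torus))
      (volume.restrict P.γ.interval) :=
    (hco.continuousOn.prodMk (hco.comp_continuousOn hC.continuousOn)).aemeasurable
      measurableSet_Ioo
  refine h1.congr ?_
  filter_upwards [ae_restrict_mem measurableSet_Ioo] with x hx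
  rw [UCurve.param, hH x hx]

theorem MeasurePair.integrableOn_ρ {L : ℝ} (P : MeasurePair L) :
    IntegrableOn P.ρ P.γ.interval :=
  not_imp_comm.1 integral_undef (by rw [P.ρ_integral]; exact one_ne_zero)

theorem MeasurePair.integral_toMeasure {L : ℝ} (P : MeasurePair L) {g : Torus → ℝ}
    (hg : Continuous g) :
    ∫ z, g z ∂P.toMeasure = ∫ x in P.γ.interval, P.ρ x * g (P.γ.param x) := by
  have hρ : AEMeasurable (fun x => ENNReal.ofReal (P.ρ x)) (volume.restrict P.γ.interval) :=
    P.integrableOn_ρ.aemeasurable.ennreal_ofReal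
  rw [MeasurePair.toMeasure, integral_map
    (P.aemeasurable_param.mono_ac (withDensity_absolutelyContinuous _ _))
    hg.aestronglyMeasurable, integral_withDensity_eq_integral_toReal_smul₀ hρ
    (by simp)]
  refine setIntegral_congr_fun measurableSet_Ioo fun x hx => ?_
  simp only [smul_eq_mul]
  rw [ENNReal.toReal_ofReal (P.ρ_pos x hx).le]

/-- The integral of a bounded function against a fully crossing pair, up to the contribution of
neighbourhoods of the two ends of the curve. -/
theorem abs_setIntegral_sub_le {f : ℝ → ℝ} {c ε : ℝ} (hf : IntegrableOn f (Ioo 0 1))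
    (hε : 0 < ε) (hε2 : ε ≤ 1 / 2) (hc : ∀ x ∈ Ioo (0 : ℝ) 1, |f x| ≤ c) :
    |(∫ x in Ioo (0 : ℝ) 1, f x) - ∫ x in ε..(1 - ε), f x| ≤ c * (2 * ε) := by
  have hsub : Ioc ε (1 - ε) ⊆ Ioo 0 1 := fun x hx =>
    ⟨hε.trans hx.1, by linarith [hx.2]⟩
  rw [intervalIntegral.integral_of_le (by linarith), ← setIntegral_sdiff measurableSet_Ioc hf hsub]
  have h := norm_setIntegral_le_of_norm_le_const (μ := volume) (s := Ioo (0 : ℝ) 1 \ Ioc ε (1 - ε))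
    (f := f) (C := c) (lt_of_le_of_lt (measure_mono sdiff_subset) (by simp)) fun x hx => hc x hx.1
  have hv : volume.real (Ioo (0 : ℝ) 1 \ Ioc ε (1 - ε)) = 2 * ε := by
    rw [measureReal_sdiff hsub measurableSet_Ioc (by simp), Real.volume_real_Ioo_of_le zero_le_one,
      Real.volume_real_Ioc_of_le (by linarith)]
    ring
  rwa [hv] at h

theorem MeasurePair.abs_integral_iterate_le {L a₀ : ℝ} (hL : 124 ^ 4 ≤ L) (P : MeasurePair L)
    (hP : P.IsFullyCrossingStandard a₀) (φ : C(UnitAddCircle, ℝ))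
    (hφ : ∫ x : UnitAddCircle, φ x = 0) (k : ℕ) {B : ℝ}
    (hB : B = 2 * Real.exp (3 * C₀) + 3 * C₀ + 1) :
    |∫ z, φ ((F L)^[k + 1] z).1 ∂P.toMeasure| ≤
      ‖φ‖ * (k * (2 * L ^ (-(3 / 4) : ℝ) * (1 + 2 * B)) +
        (2 * (1 + 2 * B) + (41 + 83 * B) + 2 * Real.exp (3 * C₀)) * L ^ (-(1 / 2) : ℝ)) := by
  have hL0 : 0 < L := lt_of_lt_of_le (by norm_num) hL
  have hK : 0 ≤ 3 * C₀ := by rw [C₀]; positivity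
  obtain ⟨⟨-, hlog⟩, hl, hr⟩ := hP
  have hI : P.γ.interval = Ioo 0 1 := by rw [UCurve.interval, hl, hr]
  obtain ⟨H, hH, hH2, hHd, hHdd⟩ := P.γ.exists_lift
  rw [hl, hr] at hH hH2 hHd hHdd
  have hρ := P.ρ_contDiffOn
  have hpos := P.ρ_pos
  have hint := P.ρ_integral
  have hρI := P.integrableOn_ρ
  have hpar := P.aemeasurable_param
  rw [hI] at hlog hρ hpos hint hρI hpar
  have hdiff : ∀ x ∈ Ioo (0 : ℝ) 1, DifferentiableAt ℝ P.ρ x := fun x hx =>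
    (hρ.differentiableOn one_ne_zero).differentiableAt (isOpen_Ioo.mem_nhds hx)
  have hsup : ∀ x ∈ Ioo (0 : ℝ) 1, P.ρ x ≤ Real.exp (3 * C₀) := fun x hx =>
    le_exp_of_abs_deriv_log_le hK hpos hdiff hint hlog hx
  -- Chosen so that `A / L = L^(-3/4)`; the condition `124 ≤ A` is what forces `124 ^ 4 ≤ L`.
  set A := L ^ (1 / 4 : ℝ) with hAdef
  set A' := L ^ (1 / 2 : ℝ) with hAdef'
  have hA : 124 ≤ A := by
    calc (124 : ℝ) = ((124 : ℝ) ^ 4) ^ (1 / 4 : ℝ) := by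
          rw [← Real.rpow_natCast, ← Real.rpow_mul (by norm_num)]; norm_num
      _ ≤ A := Real.rpow_le_rpow (by norm_num) hL (by norm_num)
  have hAA : A' = A ^ 2 := by
    rw [hAdef, hAdef', ← Real.rpow_natCast, ← Real.rpow_mul hL0.le]; norm_num
  have hA' : 124 ≤ A' := by rw [hAA]; nlinarith
  have hAL : A / L = L ^ (-(3 / 4) : ℝ) := by
    rw [hAdef, ← Real.rpow_sub_one hL0.ne']; norm_num
  have hAL' : A' / L = L ^ (-(1 / 2) : ℝ) := by
    rw [hAdef', ← Real.rpow_sub_one hL0.ne']; norm_num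
  -- Weighted curves need `C¹` data on a closed interval, but the pair is given on the open one.
  -- Trimming both ends costs at most `2ε exp(3C₀) ‖φ‖`, within the allowed error.
  set ε := L ^ (-(1 / 2) : ℝ) with hε
  have hεA : ε = A'⁻¹ := by rw [hε, Real.rpow_neg hL0.le]
  have hε0 : 0 < ε := by rw [hεA]; positivity
  have hε2 : ε ≤ 1 / 4 := by
    rw [hεA, inv_eq_one_div]
    exact one_div_le_one_div_of_le (by norm_num) (by linarith)
  have hεq : ε ≤ 1 - ε := by linarith
  have hsubI : Icc ε (1 - ε) ⊆ Ioo 0 1 := Icc_subset_Ioo hε0 (by linarith)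
  let S : WeightedCurve L ε (1 - ε) :=
    WeightedCurve.ofGraph hε0 (by linarith) H P.ρ hH2 hHd hHdd hρ hpos
  have hdρ : ∀ x ∈ Icc ε (1 - ε), |deriv P.ρ x| ≤ 3 * C₀ * P.ρ x := fun x hx =>
    abs_deriv_le_of_abs_deriv_log_le (hdiff x (hsubI hx)) (hpos x (hsubI hx))
      (hlog x (hsubI hx))
  have hm : ∫ t in ε..(1 - ε), P.ρ t ≤ 1 := by
    rw [intervalIntegral.integral_of_le hεq]
    refine le_of_le_of_eq ?_ hint
    refine setIntegral_mono_set hρI ?_ (Ioc_subset_Icc_self.trans hsubI).eventuallyLE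
    filter_upwards [ae_restrict_mem measurableSet_Ioo] with x hx using (hpos x hx).le
  have hV : S.variation ≤ B := by
    have h1 : ∫ t in ε..(1 - ε), |deriv P.ρ t| ≤ ∫ t in ε..(1 - ε), 3 * C₀ * P.ρ t :=
      intervalIntegral.integral_mono_on hεq
        (S.continuousOn_du.abs.intervalIntegrable_of_Icc hεq)
        ((S.intervalIntegrable_w hεq).const_mul _) hdρ
    rw [intervalIntegral.integral_const_mul] at h1
    have h2 := mul_le_mul_of_nonneg_left hm hK
    have hend : ∀ x ∈ Icc ε (1 - ε), |P.ρ x| ≤ Real.exp (3 * C₀) := fun x hx => by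
      rw [abs_of_pos (hpos x (hsubI hx))]; exact hsup x (hsubI hx)
    have h3 := hend ε (left_mem_Icc.2 hεq)
    have h4 := hend (1 - ε) (right_mem_Icc.2 hεq)
    change |P.ρ ε| + |P.ρ (1 - ε)| + (∫ t in ε..(1 - ε), |deriv P.ρ t|) ≤ B
    linarith
  have hB1 : 1 ≤ B := by linarith [Real.exp_pos (3 * C₀)]
  have hco : Continuous ((↑) : ℝ → UnitAddCircle) := AddCircle.continuous_mk' 1
  have hφ0 : ∫ t in (0 : ℝ)..1, φ (t : UnitAddCircle) = 0 := by
    have := UnitAddCircle.intervalIntegral_preimage 0 (fun x => φ x)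
    rw [zero_add] at this
    rw [this, hφ]
  have hmain := S.abs_integral_w_mul_iter_le hL0 hA (by linarith : 5 ≤ A') hεq hm hB1 hV
    (f := fun t : ℝ => φ (t : UnitAddCircle)) (φ.continuous.comp hco)
    (fun t => by simp only [AddCircle.coe_add_period]) hφ0
    (fun t => φ.norm_coe_le_norm _) k
  -- comparison with the integral over the whole curve
  have hg : Continuous fun z : Torus => φ ((F L)^[k + 1] z).1 :=
    φ.continuous.comp (continuous_fst.comp ((continuous_F L).iterate (k + 1)))
  rw [P.integral_toMeasure hg, hI]
  have hfI : IntegrableOn (fun x => P.ρ x * φ ((F L)^[k + 1] (P.γ.param x)).1) (Ioo 0 1) :=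
    Integrable.mul_bdd (c := ‖φ‖) hρI
      (hg.measurable.comp_aemeasurable hpar).aestronglyMeasurable
      (Filter.Eventually.of_forall fun x => φ.norm_coe_le_norm _)
  have hends := abs_setIntegral_sub_le hfI hε0 (by linarith)
    (c := Real.exp (3 * C₀) * ‖φ‖) fun x hx => by
      rw [abs_mul, abs_of_pos (hpos x hx)]
      exact mul_le_mul (hsup x hx) (φ.norm_coe_le_norm _) (abs_nonneg _) (Real.exp_pos _).le
  have heq : ∫ x in ε..(1 - ε), P.ρ x * φ ((F L)^[k + 1] (P.γ.param x)).1 =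
      ∫ x in ε..(1 - ε), S.w x * φ (((S.iter hL0.le (by linarith : 4 ≤ A) k).step hL0.le
        (by linarith : 4 ≤ A')).X x : UnitAddCircle) := by
    refine intervalIntegral.integral_congr fun x hx => ?_
    rw [uIcc_of_le hεq] at hx
    have h1 : P.γ.param x = S.proj x := by
      rw [UCurve.param, ← hH x (hsubI hx)]; rfl
    have h2 : (F L)^[k + 1] (P.γ.param x) = ((S.iter hL0.le (by linarith : 4 ≤ A) k).step hL0.le
        (by linarith : 4 ≤ A')).proj x := by
      rw [h1, Function.iterate_succ_apply',
        S.F_iterate_proj hL0.le (by linarith : 4 ≤ A), WeightedCurve.F_proj]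
    simp only [h2]
    rfl
  rw [heq] at hends
  have hquot : (41 + 83 * B) / A' = (41 + 83 * B) * ε := by rw [hεA, div_eq_mul_inv]
  rw [hAL, hAL', hquot] at hmain
  have habs := abs_sub_abs_le_abs_sub
    (∫ x in Ioo (0 : ℝ) 1, P.ρ x * φ ((F L)^[k + 1] (P.γ.param x)).1)
    (∫ x in ε..(1 - ε), S.w x * φ (((S.iter hL0.le (by linarith : 4 ≤ A) k).step hL0.le
        (by linarith : 4 ≤ A')).X x : UnitAddCircle))
  linarith

end StandardMap

end

theorem mainTheorem4 :
    ∃ C : ℝ, 0 < C ∧ ∃ L₀ : ℝ, 0 < L₀ ∧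
      ∀ a₀ : ℝ, 0 < a₀ → a₀ ≤ 1 / 8 →
      ∀ L : ℝ, L₀ ≤ L →
      ∀ P : StandardMap.MeasurePair L, P.IsFullyCrossingStandard a₀ →
      ∀ φ : C(UnitAddCircle, ℝ), ContDiff ℝ 1 (fun x : ℝ => φ (x : UnitAddCircle)) →
        ∫ x : UnitAddCircle, φ x = 0 →
      ∀ n : ℕ, 1 ≤ n →
        |∫ p, φ ((StandardMap.F L)^[n] p).1 ∂P.toMeasure| ≤
          C * (‖φ‖ * (((n : ℝ) - 1) * L ^ (-(3 / 4) : ℝ) + L ^ (-(1 / 2) : ℝ))) := by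
  obtain ⟨B, hB⟩ : ∃ B, B = 2 * Real.exp (3 * StandardMap.C₀) + 3 * StandardMap.C₀ + 1 := ⟨_, rfl⟩
  have hE := Real.exp_pos (3 * StandardMap.C₀)
  have hK : 0 ≤ 3 * StandardMap.C₀ := by rw [StandardMap.C₀]; positivity
  have hB0 : 0 < B := by linarith
  -- This is the coefficient of `L^(-1/2)`; its first summand is already the coefficient of
  -- `L^(-3/4)`.
  refine ⟨2 * (1 + 2 * B) + (41 + 83 * B) + 2 * Real.exp (3 * StandardMap.C₀), by positivity,
    124 ^ 4, by norm_num, ?_⟩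
  intro a₀ _ _ L hL P hP φ _ hφ n hn
  -- The last of the `n = k + 1` steps uses the larger threshold, hence the factor `n - 1`.
  obtain ⟨k, rfl⟩ := Nat.exists_eq_add_of_le' hn
  have hL0 : 0 < L := lt_of_lt_of_le (by norm_num) hL
  refine (P.abs_integral_iterate_le hL hP φ hφ k hB).trans ?_
  rw [mul_left_comm _ ‖φ‖]
  refine mul_le_mul_of_nonneg_left ?_ (norm_nonneg φ)
  have h : 0 ≤ (k : ℝ) * L ^ (-(3 / 4) : ℝ) := by positivity
  have h2 : 0 ≤ (41 + 83 * B) + 2 * Real.exp (3 * StandardMap.C₀) := by positivity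
  push_cast
  nlinarith [mul_nonneg h h2]
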